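/- **Setting.** Let $\mathcal P$ be the set of continuous functions $f:\mathbb R^3\to[0,\infty)$ whose support $K_f$ is compact and connected, contains the origin in its interior, and has as boundary a finite disjoint union of closed (i.e. compact, without boundary) connected topological surfaces embedded in $\mathbb R^3$. For $f\in\mathcal P$ let $R(f)=\inf\{r : K_f\subset B_r(0)\}$, let $S_f$ be the sphere of radius $R(f)$ about the origin (the Brillouin sphere), and let $V_f(x)=G\int_{\mathbb R^3}\frac{f(y)}{|x-y|}\,dy$ be the gravitational potential, where $G>0$ is a constant. The free space of $f$ is the unbounded component of $\mathbb R^3\setminus K_f$. For $1\le p<\infty$ and a weight $w:\mathbb R^3\to[0,\infty)$ put $\|g\|_{p,w}=\left(\int|g|^p w\,dx\right)^{1/p}$, and let $\|g\|_{\infty,w}=\sup|g|$; let $\mu_{p,w}(g,h)=\|g-h\|_{p,w}$ and $\mu_{N,p,w}(g,h)=\|\chi_N(g-h)\|_{p,w}$, with $\chi_N$ the characteristic function of the closed ball of radius $N$ about the origin. Let $d$ be the Hausdorff distance. Let $\overline Y_{n,m}$ be the real spherical harmonics, normalized to have mean square one on the unit sphere. With $M=\int f$, $R=R(f)$ and $(r,\theta,\phi)$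 spherical coordinates, the spherical harmonic expansion of $V_f$ is the series with partial sums $$SHE_k(V_f)=\frac{GM}{R}\sum_{n=0}^{k}\sum_{m=-n}^{n}\left(\frac Rr\right)^{n+1}C_{n,m}\overline Y_{n,m}(\theta,\phi),\qquad C_{n,m}=\frac{1}{M(2n+1)}\int_{\mathbb R^3}\left(\frac{|y|}{R}\right)^{n}\overline Y_{n,m}(\theta_y,\phi_y)f(y)\,dy .$$ It is said to $\varepsilon$-descend if, for every $r>R(f)-\varepsilon$, the functions $SHE_k(V_f)$ converge uniformly as $k\to\infty$ on the set of those points $x$ of the free space of $f$ with $r<|x|<R(f)$. **Theorem.** For every $f\in\mathcal P$, every $p$ with $1\le p\le\infty$, every smooth function $w:\mathbb R^3\to[0,\infty)$, every real $N>0$ and every $\varepsilon>0$ there is $f_\varepsilon\in\mathcal P$ such that (a) $\mu_{p,w}(f,f_\varepsilon)<\varepsilon$; (b) $d(K_{f_\varepsilon},K_f)<\varepsilon$ and $d(\partial K_{f_\varepsilon},\partial K_f)<\varepsilon$; (c) $\mu_{N,p,w}(V_f,V_{f_\varepsilon})<\varepsilon$; (d) $d(S_f,S_{f_\varepsilon})<\varepsilon$;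 (e) the spherical harmonic expansion of $V_{f_\varepsilon}$ does not $\varepsilon$-descend. -/

import Mathlib

open MeasureTheory Filter Topology
open scoped ENNReal

namespace Planet

/-- Euclidean three-space. -/
abbrev E3 : Type := EuclideanSpace ℝ (Fin 3)

/-! ### Planets -/

/-- A closed (compact, without boundary), connected topological surface embedded in `ℝ³`: with the
subspace topology it is locally homeomorphic to the plane (no local flatness is required). -/
structure IsClosedSurface (S : Set E3) : Prop where
  isCompact : IsCompact S
  isConnected : IsConnected S
  locallyEuclidean : Nonempty (ChartedSpace (EuclideanSpace ℝ (Fin 2)) S)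

/-- The class of planet densities: continuous nonnegative functions with compact connected
support, whose boundary is a finite disjoint union of closed connected surfaces, and such that the
origin is an interior point of the support. -/
structure IsPlanet (f : E3 → ℝ) : Prop where
  continuous : Continuous f
  nonneg : ∀ x, 0 ≤ f x
  hasCompactSupport : HasCompactSupport f
  isConnected : IsConnected (tsupport f)
  boundary : ∃ (m : ℕ) (S : Fin m → Set E3), (∀ i, IsClosedSurface (S i)) ∧
    Pairwise (fun i j => Disjoint (S i) (S j)) ∧ frontier (tsupport f) = ⋃ i, S i
  zero_mem : (0 : E3) ∈ interior (tsupport f)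

/-- The Brillouin radius: the infimum of the radii of the balls centred at the origin that contain
the support. -/
noncomputable def brillouinRadius (f : E3 → ℝ) : ℝ :=
  sInf {r : ℝ | tsupport f ⊆ Metric.ball 0 r}

/-- The Brillouin sphere. -/
noncomputable def brillouinSphere (f : E3 → ℝ) : Set E3 :=
  Metric.sphere 0 (brillouinRadius f)

/-- The free space above the topography: the unbounded component of the complement of the
support. -/
def freeSpace (f : E3 → ℝ) : Set E3 :=
  {x | x ∉ tsupport f ∧ ¬ Bornology.IsBounded (connectedComponentIn (tsupport f)ᶜ x)}

/-! ### Weighted norms -/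

/-- The `w`-weighted `L^p` norm `(∫ |g|^p w dx)^(1/p)`, with value in `[0, ∞]`; for `p = ∞` it is
the sup norm. -/
noncomputable def weightedNorm (p : ℝ≥0∞) (w g : E3 → ℝ) : ℝ≥0∞ :=
  if p = ⊤ then ⨆ x, ‖g x‖ₑ
  else (∫⁻ x, ‖g x‖ₑ ^ p.toReal * ENNReal.ofReal (w x)) ^ (1 / p.toReal)

/-- The distance associated with the weighted norm. -/
noncomputable def weightedDist (p : ℝ≥0∞) (w f g : E3 → ℝ) : ℝ≥0∞ :=
  weightedNorm p w (fun x => f x - g x)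

/-- The weighted distance between the restrictions of two functions to the closed ball of radius
`N` about the origin. -/
noncomputable def weightedDistOn (N : ℝ) (p : ℝ≥0∞) (w f g : E3 → ℝ) : ℝ≥0∞ :=
  weightedNorm p w ((Metric.closedBall (0 : E3) N).indicator (fun x => f x - g x))

/-! ### Potential and its spherical harmonic expansion -/

/-- The gravitational potential of the density `f`, with gravitational constant `G`. -/
noncomputable def potential (G : ℝ) (f : E3 → ℝ) (x : E3) : ℝ :=
  G * ∫ y, f y / ‖x - y‖

/-- The total mass. -/
noncomputable def mass (f : E3 → ℝ) : ℝ := ∫ y, f y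

/-- The Legendre polynomial of degree `n`, by Rodrigues' formula. -/
noncomputable def legendre (n : ℕ) : Polynomial ℝ :=
  Polynomial.C (1 / (2 ^ n * (n.factorial : ℝ))) *
    Polynomial.derivative^[n] ((Polynomial.X ^ 2 - 1) ^ n)

/-- The associated Legendre function of degree `n` and order `k`, without the Condon-Shortley
phase: `(1 - t²)^(k/2) dᵏ/dtᵏ Pₙ(t)`. -/
noncomputable def assocLegendre (n k : ℕ) (t : ℝ) : ℝ :=
  Real.sqrt (1 - t ^ 2) ^ k * (Polynomial.derivative^[k] (legendre n)).eval t

/-- The real spherical harmonic of degree `n` and order `m`, `|m| ≤ n`, at colatitude `θ` and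
longitude `φ`, normalized so that the mean of its square over the unit sphere is one. -/
noncomputable def sphericalHarmonic (n : ℕ) (m : ℤ) (θ φ : ℝ) : ℝ :=
  Real.sqrt ((if m = 0 then 1 else 2) * (2 * n + 1) *
      ((n - m.natAbs).factorial : ℝ) / ((n + m.natAbs).factorial : ℝ)) *
    assocLegendre n m.natAbs (Real.cos θ) *
    (if 0 ≤ m then Real.cos (m.natAbs * φ) else Real.sin (m.natAbs * φ))

/-- Colatitude (angle with the third axis). -/
noncomputable def colatitude (x : E3) : ℝ := Real.arccos (x 2 / ‖x‖)

/-- Longitude. -/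
noncomputable def longitude (x : E3) : ℝ := Complex.arg ⟨x 0, x 1⟩

/-- The coefficient `C_{n,m}` of the spherical harmonic expansion of the potential of `f`, with
the Brillouin radius as reference radius. -/
noncomputable def sheCoeff (f : E3 → ℝ) (n : ℕ) (m : ℤ) : ℝ :=
  1 / (mass f * (2 * n + 1)) *
    ∫ y, (‖y‖ / brillouinRadius f) ^ n *
      sphericalHarmonic n m (colatitude y) (longitude y) * f y

/-- The truncation at degree `k` of the spherical harmonic expansion (centred at infinity) of the
potential of `f`. -/
noncomputable def she (G : ℝ) (f : E3 → ℝ) (k : ℕ) (x : E3) : ℝ :=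
  G * mass f / brillouinRadius f *
    ∑ n ∈ Finset.range (k + 1), ∑ m ∈ Finset.Icc (-(n : ℤ)) n,
      (brillouinRadius f / ‖x‖) ^ (n + 1) * sheCoeff f n m *
        sphericalHarmonic n m (colatitude x) (longitude x)

/-- The expansion of the potential of `f` converges uniformly on `S` (to some function). -/
def SHEConvergesUniformlyOn (G : ℝ) (f : E3 → ℝ) (S : Set E3) : Prop :=
  ∃ g : E3 → ℝ, TendstoUniformlyOn (she G f) g atTop S

/-- The expansion of the potential of `f` descends a distance `ε` below the Brillouin sphere: for
all `r > R(f) - ε` it converges uniformly on the part beyond radius `r` of the free space between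
the topography and the Brillouin sphere. -/
def Descends (G : ℝ) (f : E3 → ℝ) (ε : ℝ) : Prop :=
  ∀ r : ℝ, brillouinRadius f - ε < r →
    SHEConvergesUniformlyOn G f {x | x ∈ freeSpace f ∧ r < ‖x‖ ∧ ‖x‖ < brillouinRadius f}

end Planet

/-!
The perturbation has two parts: a small translation, and a small amount of mass added inside the
support of the translated density.

Let `y` be a point of the support `K` of `f` at maximal distance `R` from the origin. Translating
`f` by a vector `v` of length `t < ε` in the direction of `y` yields a planet with Brillouin radius
`R + t` whose support lies in the closed ball of radius `R` about `v`. Hence a point `x` of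
the polar axis with `‖x‖ = R`, on the side of the origin opposite to `y`, lies in the free space, at
depth `t` below the Brillouin sphere. Translation preserves the topological conditions on
the boundary, so no surface has to be modified.

On the polar axis only the zonal harmonics survive, so the `n`-th term of the expansion at `x` is,
up to sign, `G A n / R ^ (n + 1)`, where `A n` is the integral of `|y|ⁿ Pₙ(cos θ)` against
the density (`she_axis`). If the expansion descends, then `A n = O(Rⁿ)`
(`Descends.axialMoment_le`). The translated planet has positive density at some point beyond radius
`R`, hence on a small ball there, and `exists_unbounded_axialMoment` provides a continuous
nonnegative `η` supported in that ball with moments that are not `O(Rⁿ)`. Since the moments are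
linear in the density, the expansion cannot descend both for the translated planet and
for the planet with a small multiple of `η` added. These two planets have the same support.

The density `η` comes from the Banach-Steinhaus theorem: if every `η` had moments `O(Rⁿ)`, the `L¹`
norms of the zonal solid harmonics over the ball would be `O(Rⁿ)`, and as the ball lies beyond some
radius `ρ > R`, the series `∑ |Pₙ(cos θ)|` would converge almost everywhere on it. But
`∑ |Pₙ(c)|` diverges for every real `c` (`not_summable_legendre_eval`), because
the square of the generating function `∑ Pₙ(c) zⁿ` is `1 / (1 - 2 c z + z²)`, whose coefficients do
not tend to zero.
-/

namespace Planet

/-! ### Legendre polynomials -/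

theorem legendre_eval_zero (c : ℝ) : (legendre 0).eval c = 1 := by
  simp [legendre]

theorem legendre_eval_one (c : ℝ) : (legendre 1).eval c = c := by
  simp [legendre]
  ring

open Polynomial in
/-- Bonnet's recursion. With `u = X² - 1`, both `D(u^(n+2))` and `D²(u^(n+2))` are expressed through
lower powers of `u`; eliminating `Dⁿ(u^(n+1))` from the two formulas gives the recursion. -/
theorem legendre_eval_add_two (n : ℕ) (c : ℝ) :
    (n + 2) * (legendre (n + 2)).eval c =
      (2 * n + 3) * c * (legendre (n + 1)).eval c - (n + 1) * (legendre n).eval c := by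
  set u : ℝ[X] := X ^ 2 - 1 with hu
  have hder : derivative u = 2 * X := by
    simp [hu]
    norm_num
  have h1 : derivative (u ^ (n + 2)) = C (2 * ((n : ℝ) + 2)) * (u ^ (n + 1) * X) := by
    rw [derivative_pow_succ, hder]
    simp only [map_mul, map_add, map_natCast, map_ofNat, map_one]
    push_cast
    ring
  have h2 : derivative (derivative (u ^ (n + 2))) =
      C (2 * ((n : ℝ) + 2) * (2 * n + 3)) * u ^ (n + 1) +
        C (2 * ((n : ℝ) + 2) * (2 * (n + 1))) * u ^ n := by
    rw [h1, derivative_C_mul, derivative_mul, derivative_pow_succ, hder, derivative_X]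
    simp only [map_mul, map_add, map_natCast, map_ofNat, map_one]
    have : u ^ (n + 1) = u ^ n * (X ^ 2 - 1) := by rw [pow_succ]
    rw [this]
    ring
  have e1 : derivative^[n + 2] (u ^ (n + 2)) = C (2 * ((n : ℝ) + 2)) *
      (derivative^[n + 1] (u ^ (n + 1)) * X + C ((n : ℝ) + 1) * derivative^[n] (u ^ (n + 1))) := by
    rw [Function.iterate_succ_apply, h1, iterate_derivative_C_mul, iterate_derivative_mul_X]
    simp [nsmul_eq_mul]
  have e2 : derivative^[n + 2] (u ^ (n + 2)) =
      C (2 * ((n : ℝ) + 2) * (2 * n + 3)) * derivative^[n] (u ^ (n + 1)) +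
        C (2 * ((n : ℝ) + 2) * (2 * (n + 1))) * derivative^[n] (u ^ n) := by
    rw [Function.iterate_add_apply]
    change derivative^[n] (derivative (derivative (u ^ (n + 2)))) = _
    rw [h2, iterate_map_add, iterate_derivative_C_mul, iterate_derivative_C_mul]
  have f1 := congrArg (Polynomial.eval c) e1
  have f2 := congrArg (Polynomial.eval c) e2
  simp only [eval_mul, eval_add, eval_C, eval_X] at f1 f2
  simp only [legendre, eval_mul, eval_C, ← hu]
  set L2 := (derivative^[n + 2] (u ^ (n + 2))).eval c
  set L1 := (derivative^[n + 1] (u ^ (n + 1))).eval c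
  set L0 := (derivative^[n] (u ^ n)).eval c
  set Q := (derivative^[n] (u ^ (n + 1))).eval c
  have hf : (n.factorial : ℝ) ≠ 0 := by positivity
  have hn1 : (n : ℝ) + 1 ≠ 0 := by positivity
  have hn2 : (n : ℝ) + 2 ≠ 0 := by positivity
  have hL : L2 = 2 * (2 * n + 3) * c * L1 - 4 * (n + 1) ^ 2 * L0 := by
    apply mul_left_cancel₀ hn2
    linear_combination (2 * n + 3) * f1 - (n + 1) * f2
  have k1 : 1 / (2 ^ (n + 1) * ((n + 1).factorial : ℝ)) =
      1 / (2 ^ n * (n.factorial : ℝ)) / (2 * (n + 1)) := by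
    rw [Nat.factorial_succ, pow_succ]
    push_cast
    field_simp
  have k2 : 1 / (2 ^ (n + 2) * ((n + 2).factorial : ℝ)) =
      1 / (2 ^ n * (n.factorial : ℝ)) / (4 * (n + 1) * (n + 2)) := by
    rw [Nat.factorial_succ, Nat.factorial_succ, pow_add]
    push_cast
    rw [show (n : ℝ) + 1 + 1 = n + 2 by ring]
    field_simp
    norm_num
  rw [k1, k2, hL]
  field_simp
  ring

/-- At `±1` the Legendre polynomials have absolute value one. -/
theorem legendre_eval_of_sq_eq_one {c : ℝ} (hc : c ^ 2 = 1) (n : ℕ) :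
    (legendre n).eval c = c ^ n := by
  induction n using Nat.twoStepInduction with
  | zero => simp [legendre_eval_zero]
  | one => simp [legendre_eval_one]
  | more n h0 h1 =>
    have h := legendre_eval_add_two n c
    have hn2 : (n : ℝ) + 2 ≠ 0 := by positivity
    apply mul_left_cancel₀ hn2
    rw [h, h0, h1, pow_succ, pow_succ]
    linear_combination (n + 1) * c ^ n * hc

open PowerSeries in
/-- The generating function `F = ∑ Pₙ(c) Xⁿ` satisfies `(1 - 2 c X + X²) F² = 1`: by Bonnet's
recursion `(1 - 2 c X + X²) F' = (c - X) F`, so that the left-hand side has derivative zero. -/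
theorem legendre_generating_sq (c : ℝ) :
    (1 - PowerSeries.C (2 * c) * X + X ^ 2) *
      (PowerSeries.mk (fun n => (legendre n).eval c)) ^ 2 = 1 := by
  set F : PowerSeries ℝ := PowerSeries.mk (fun n => (legendre n).eval c) with hF
  have hode : (1 - PowerSeries.C (2 * c) * X + X ^ 2) * derivative ℝ F =
      (PowerSeries.C c - X) * F := by
    have hx : ∀ g : PowerSeries ℝ, (1 - PowerSeries.C (2 * c) * X + X ^ 2) * g =
      g - PowerSeries.C (2 * c) * (X * g) + X * (X * g) := fun g => by ring
    rw [hx, sub_mul]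
    ext n
    match n with
    | 0 =>
      have h0 : coeff 0 (derivative ℝ F) = c := by
        simp only [coeff_derivative, hF, coeff_mk, zero_add, legendre_eval_one]
        simp
      rw [coeff_zero_eq_constantCoeff] at h0
      simp [h0]
      simp [hF, legendre_eval_zero]
    | 1 =>
      have := legendre_eval_add_two 0 c
      have h0 : coeff 0 (derivative ℝ F) = c := by
        simp only [coeff_derivative, hF, coeff_mk, zero_add, legendre_eval_one]
        simp
      simp only [map_add, map_sub, coeff_C_mul, coeff_succ_X_mul 0, h0]
      simp only [coeff_derivative, hF, coeff_mk, legendre_eval_one, legendre_eval_zero]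
      simp only [zero_add, Nat.cast_zero, legendre_eval_one, legendre_eval_zero] at this
      norm_num at this ⊢
      linarith
    | n + 2 =>
      have := legendre_eval_add_two (n + 1) c
      simp only [map_add, map_sub, coeff_C_mul, coeff_succ_X_mul, coeff_derivative, hF,
        coeff_mk] at this ⊢
      push_cast at this ⊢
      linarith
  apply derivative.ext
  · have hd : derivative ℝ (1 - PowerSeries.C (2 * c) * X + X ^ 2) =
        2 * X - PowerSeries.C (2 * c) := by
      simp [Derivation.leibniz, Derivation.leibniz_pow, smul_eq_mul]
      ring
    rw [Derivation.leibniz, Derivation.leibniz_pow, hd]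
    simp only [smul_eq_mul, Derivation.map_one_eq_zero]
    have h2 : PowerSeries.C (2 * c) = 2 * PowerSeries.C c := by
      rw [map_mul, map_ofNat]
    simp only [nsmul_eq_mul]
    rw [h2] at hode ⊢
    push_cast
    linear_combination (2 * F) * hode
  · simp [hF, legendre_eval_zero]

/-- For every real `c` the series `∑ |Pₙ(c)|` diverges. Otherwise the Cauchy square `b` of
`Pₙ(c)` would tend to zero, but by the generating function `b (n + 2) = 2 c b (n + 1) - b n`, a
recursion with the invariant `b (n + 1)² - 2 c b n b (n + 1) + b n² = 1`. -/
theorem not_summable_legendre_eval (c : ℝ) :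
    ¬ Summable (fun n => |(legendre n).eval c|) := by
  intro hs
  set a : ℕ → ℝ := fun n => (legendre n).eval c with ha
  set b : ℕ → ℝ := fun n => ∑ kl ∈ Finset.HasAntidiagonal.antidiagonal n, a kl.1 * a kl.2 with hb
  have hb0 : Tendsto b atTop (𝓝 0) := by
    have h := summable_norm_sum_mul_antidiagonal_of_summable_norm (f := a) (g := a)
      (by simpa using hs) (by simpa using hs)
    exact tendsto_zero_iff_norm_tendsto_zero.2 h.tendsto_atTop_zero
  have hcoeff : ∀ n, PowerSeries.coeff n (PowerSeries.mk a ^ 2) = b n := fun n => by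
    rw [sq, PowerSeries.coeff_mul]
    simp [hb]
  have hgen := legendre_generating_sq c
  have hx : ∀ g : PowerSeries ℝ,
      (1 - PowerSeries.C (2 * c) * PowerSeries.X + PowerSeries.X ^ 2) * g =
        g - PowerSeries.C (2 * c) * (PowerSeries.X * g) +
          PowerSeries.X * (PowerSeries.X * g) := fun g => by ring
  rw [hx] at hgen
  have hrec : ∀ n, b (n + 2) = 2 * c * b (n + 1) - b n := fun n => by
    have h := congrArg (PowerSeries.coeff (n + 2)) hgen
    simp only [map_add, map_sub, PowerSeries.coeff_C_mul, PowerSeries.coeff_succ_X_mul, ← ha, hcoeff,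
      PowerSeries.coeff_one] at h
    rw [if_neg (by omega)] at h
    linarith
  have hinv : ∀ n, b (n + 1) ^ 2 - 2 * c * b n * b (n + 1) + b n ^ 2 = 1 := fun n => by
    induction n with
    | zero =>
      have h1 : b 1 = 2 * c := by
        simp [hb, ha, legendre_eval_zero, legendre_eval_one,
          Finset.Nat.antidiagonal_succ]
        ring
      have h0 : b 0 = 1 := by simp [hb, ha, legendre_eval_zero]
      rw [h1, h0]; ring
    | succ n ih =>
      rw [hrec n]
      linear_combination ih
  have hb1 : Tendsto (fun n => b (n + 1)) atTop (𝓝 0) := (tendsto_add_atTop_iff_nat 1).2 hb0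
  have hlim : Tendsto (fun n => b (n + 1) ^ 2 - 2 * c * b n * b (n + 1) + b n ^ 2) atTop
      (𝓝 (0 ^ 2 - 2 * c * 0 * 0 + 0 ^ 2)) :=
    ((hb1.pow 2).sub ((hb0.const_mul _).mul hb1)).add (hb0.pow 2)
  simp only [hinv] at hlim
  have := tendsto_nhds_unique hlim tendsto_const_nhds
  norm_num at this

/-! ### Axial multipole moments -/

/-- The zonal solid harmonic `|y|ⁿ Pₙ(cos θ)` of degree `n`. -/
noncomputable def zonal (n : ℕ) (y : E3) : ℝ := ‖y‖ ^ n * (legendre n).eval (y 2 / ‖y‖)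

/-- The moment of the density `f` against the zonal solid harmonic of degree `n`. -/
noncomputable def axialMoment (n : ℕ) (f : E3 → ℝ) : ℝ := ∫ y, zonal n y * f y

theorem measurable_zonal (n : ℕ) : Measurable (zonal n) := by
  have h2 : Measurable fun y : E3 => y 2 := by fun_prop
  exact (measurable_norm.pow_const n).mul
    ((legendre n).continuous.measurable.comp (h2.div measurable_norm))

theorem continuousAt_zonal (n : ℕ) {y : E3} (hy : y ≠ 0) : ContinuousAt (zonal n) y := by
  have hy' : ‖y‖ ≠ 0 := norm_ne_zero_iff.2 hy
  have h2 : ContinuousAt (fun y : E3 => y 2 / ‖y‖) y := by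
    refine ContinuousAt.div ?_ continuous_norm.continuousAt hy'
    exact Continuous.continuousAt (by fun_prop)
  exact (continuous_norm.continuousAt.pow n).mul
    ((legendre n).continuous.continuousAt.comp h2)

theorem abs_coord_div_norm_le (y : E3) : |y 2 / ‖y‖| ≤ 1 := by
  rw [abs_div, abs_norm]
  exact div_le_one_of_le₀ (by simpa using PiLp.norm_apply_le y 2) (norm_nonneg y)

theorem exists_zonal_bound (n : ℕ) (r : ℝ) : ∃ B, ∀ y : E3, ‖y‖ ≤ r → |zonal n y| ≤ B := by
  obtain ⟨B, hB⟩ := (isCompact_Icc (a := (-1 : ℝ)) (b := 1)).exists_bound_of_continuousOn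
    (legendre n).continuous.continuousOn
  refine ⟨|r| ^ n * |B|, fun y hy => ?_⟩
  rw [zonal, abs_mul, abs_pow, abs_norm]
  refine mul_le_mul ?_ ?_ (abs_nonneg _) (by positivity)
  · exact pow_le_pow_left₀ (norm_nonneg y) (hy.trans (le_abs_self r)) n
  · exact (hB _ (abs_le.1 (abs_coord_div_norm_le y))).trans (le_abs_self B)

theorem integrable_zonal_mul (n : ℕ) {f : E3 → ℝ} (hf : Continuous f) (hc : HasCompactSupport f) :
    Integrable fun y => zonal n y * f y := by
  obtain ⟨r, hr⟩ := hc.isCompact.isBounded.subset_closedBall 0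
  obtain ⟨B, hB⟩ := exists_zonal_bound n r
  have hfi : Integrable f := hf.integrable_of_hasCompactSupport hc
  refine (hfi.norm.const_mul B).mono'
    ((measurable_zonal n).aestronglyMeasurable.mul hf.aestronglyMeasurable)
    (Eventually.of_forall fun y => ?_)
  rw [norm_mul]
  by_cases hy : f y = 0
  · simp [hy]
  · gcongr
    exact hB y (by simpa using hr (subset_tsupport f hy))

theorem axialMoment_add_smul (n : ℕ) {f g : E3 → ℝ} (hf : Continuous f)
    (hfc : HasCompactSupport f) (hg : Continuous g) (hgc : HasCompactSupport g) (c : ℝ) :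
    axialMoment n (fun y => f y + c * g y) = axialMoment n f + c * axialMoment n g := by
  simp only [axialMoment]
  rw [← integral_const_mul, ← integral_add (integrable_zonal_mul n hf hfc)
    ((integrable_zonal_mul n hg hgc).const_mul c)]
  congr 1
  ext y
  ring

/-- The cone function with base `ball q δ` and height `δ`. -/
noncomputable def cone (q : E3) (δ : ℝ) (y : E3) : ℝ := max 0 (δ - dist y q)

theorem continuous_cone (q : E3) (δ : ℝ) : Continuous (cone q δ) := by
  unfold cone; fun_prop

theorem cone_nonneg (q : E3) (δ : ℝ) (y : E3) : 0 ≤ cone q δ y := le_max_left _ _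

theorem cone_le {q : E3} {δ : ℝ} (hδ : 0 ≤ δ) (y : E3) : cone q δ y ≤ δ :=
  max_le hδ (by linarith [dist_nonneg (x := y) (y := q)])

theorem cone_pos {q : E3} {δ : ℝ} {y : E3} (hy : y ∈ Metric.ball q δ) : 0 < cone q δ y :=
  lt_max_of_lt_right (by simpa using hy)

theorem cone_eq_zero {q : E3} {δ : ℝ} {y : E3} (hy : y ∉ Metric.ball q δ) : cone q δ y = 0 :=
  max_eq_left (by simpa using hy)

theorem hasCompactSupport_cone_mul (q : E3) (δ : ℝ) (g : E3 → ℝ) :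
    HasCompactSupport fun y => cone q δ y * g y := by
  refine HasCompactSupport.of_support_subset_isCompact (isCompact_closedBall q δ) fun y hy => ?_
  by_contra h
  refine hy ?_
  simp [cone_eq_zero fun h' => h (Metric.ball_subset_closedBall h')]

theorem integrable_zonal_cone (n : ℕ) (q : E3) (δ : ℝ) :
    Integrable fun y => zonal n y * cone q δ y :=
  integrable_zonal_mul n (continuous_cone q δ) (by simpa using hasCompactSupport_cone_mul q δ 1)

/-- If the ball lies outside the sphere of radius `s` about the origin, then the zonal solid
harmonics weighted with the cone function are not `O(sⁿ)` in `L¹`: otherwise `∑ |Pₙ(cos θ)|` would be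
finite almost everywhere on the ball. -/
theorem not_integral_zonal_cone_le {q : E3} {δ s ρ : ℝ} (hδ : 0 < δ) (hs : 0 < s) (hsρ : s < ρ)
    (hball : ∀ y ∈ Metric.ball q δ, ρ ≤ ‖y‖) (C : ℝ) :
    ¬ ∀ n, ∫ y, |zonal n y * cone q δ y| ≤ C * s ^ n := by
  intro hC
  have hρ : 0 < ρ := hs.trans hsρ
  set P : ℕ → E3 → ℝ := fun n y => |(legendre n).eval (y 2 / ‖y‖)| * cone q δ y with hP
  have hPm : ∀ n, Measurable (P n) := fun n => by
    have h2 : Measurable fun y : E3 => y 2 := by fun_prop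
    have := (legendre n).continuous.measurable.comp (h2.div measurable_norm)
    exact (continuous_abs.measurable.comp this).mul (continuous_cone q δ).measurable
  have hP0 : ∀ n y, 0 ≤ P n y := fun n y => mul_nonneg (abs_nonneg _) (cone_nonneg _ _ _)
  have hPle : ∀ n, ∫⁻ y, ENNReal.ofReal (P n y) ≤ ENNReal.ofReal (C * (s / ρ) ^ n) := fun n => by
    have hle : ∀ y, P n y ≤ (ρ ^ n)⁻¹ * |zonal n y * cone q δ y| := fun y => by
      by_cases hy : y ∈ Metric.ball q δ
      · rw [le_inv_mul_iff₀ (by positivity), abs_mul, abs_of_nonneg (cone_nonneg _ _ _), zonal,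
          abs_mul, abs_pow, abs_norm, hP, mul_assoc]
        have := hP0 n y
        have := hball y hy
        simp only
        gcongr
      · simp [hP, cone_eq_zero hy]
    calc ∫⁻ y, ENNReal.ofReal (P n y)
        ≤ ∫⁻ y, ENNReal.ofReal ((ρ ^ n)⁻¹ * |zonal n y * cone q δ y|) :=
          lintegral_mono fun y => ENNReal.ofReal_le_ofReal (hle y)
      _ = ENNReal.ofReal (∫ y, (ρ ^ n)⁻¹ * |zonal n y * cone q δ y|) := by
          rw [ofReal_integral_eq_lintegral_ofReal
            ((integrable_zonal_cone n q δ).abs.const_mul _)]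
          exact Eventually.of_forall fun y => by positivity
      _ ≤ ENNReal.ofReal (C * (s / ρ) ^ n) := by
          apply ENNReal.ofReal_le_ofReal
          rw [integral_const_mul, div_pow, inv_mul_le_iff₀ (by positivity)]
          calc _ ≤ C * s ^ n := hC n
            _ = _ := by field_simp
  have hC0 : 0 ≤ C := by
    have h0 := (integral_nonneg fun y => abs_nonneg (zonal 0 y * cone q δ y)).trans (hC 0)
    simpa using h0
  have hsum : ∫⁻ y, ∑' n, ENNReal.ofReal (P n y) < ⊤ := by
    rw [lintegral_tsum fun n => (hPm n).ennreal_ofReal.aemeasurable]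
    refine (ENNReal.tsum_le_tsum hPle).trans_lt ?_
    have hg : Summable fun n => C * (s / ρ) ^ n :=
      (summable_geometric_of_lt_one (by positivity) ((div_lt_one hρ).2 hsρ)).mul_left C
    rw [← ENNReal.ofReal_tsum_of_nonneg (fun n => by positivity) hg]
    exact ENNReal.ofReal_lt_top
  have hae := ae_lt_top (Measurable.tsum fun n => (hPm n).ennreal_ofReal) hsum.ne
  obtain ⟨y, hy, hyball⟩ : ∃ y, ∑' n, ENNReal.ofReal (P n y) < ⊤ ∧ y ∈ Metric.ball q δ := by
    by_contra! h
    have hnull : volume (Metric.ball q δ) = 0 :=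
      measure_mono_null (fun y hy => fun hlt => h y hlt hy) (ae_iff.1 hae)
    exact (Metric.measure_ball_pos volume q hδ).ne' hnull
  have hsummable : Summable fun n => P n y := by
    have h := ENNReal.summable_toReal hy.ne
    simpa [ENNReal.toReal_ofReal, hP0] using h
  refine not_summable_legendre_eval (y 2 / ‖y‖) ?_
  exact (summable_mul_right_iff (cone_pos hyball).ne').1 hsummable

/-- A density supported in a ball beyond radius `s` whose axial moments are not `O(sⁿ)`. If there
were none, the Banach-Steinhaus theorem would bound the moments, divided by `sⁿ`, uniformly on
the unit ball of the bounded continuous functions; evaluating them at regularized signs of the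
zonal harmonics contradicts `not_integral_zonal_cone_le`. -/
theorem exists_unbounded_axialMoment {q : E3} {δ s ρ : ℝ} (hδ : 0 < δ) (hs : 0 < s) (hsρ : s < ρ)
    (hball : ∀ y ∈ Metric.closedBall q δ, ρ ≤ ‖y‖) :
    ∃ η : E3 → ℝ, Continuous η ∧ (∀ y, 0 ≤ η y) ∧ (∃ b, ∀ y, η y ≤ b) ∧
      Function.support η ⊆ Metric.ball q δ ∧ HasCompactSupport η ∧
      ∀ C, ∃ n, C * s ^ n < |axialMoment n η| := by
  by_contra hcon
  have hbdd : ∀ g : BoundedContinuousFunction E3 ℝ, (∀ y, 0 ≤ g y) →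
      ∃ C, ∀ n, |axialMoment n fun y => cone q δ y * g y| ≤ C * s ^ n := by
    intro g hg
    by_contra! h
    refine hcon ⟨fun y => cone q δ y * g y, (continuous_cone q δ).mul g.continuous,
      fun y => mul_nonneg (cone_nonneg _ _ _) (hg y), ⟨δ * ‖g‖, fun y => ?_⟩, fun y hy => ?_,
      hasCompactSupport_cone_mul q δ g, h⟩
    · exact mul_le_mul (cone_le hδ.le y) ((le_abs_self _).trans (g.norm_coe_le_norm y)) (hg y) hδ.le
    · by_contra hy'
      exact hy (by simp [cone_eq_zero hy'])
  have hint : ∀ (n : ℕ) (g : BoundedContinuousFunction E3 ℝ),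
      Integrable fun y => zonal n y * (cone q δ y * g y) := fun n g =>
    integrable_zonal_mul n ((continuous_cone q δ).mul g.continuous)
      (hasCompactSupport_cone_mul q δ g)
  let T : ℕ → BoundedContinuousFunction E3 ℝ →L[ℝ] ℝ := fun n =>
    LinearMap.mkContinuous
      { toFun := fun g => (s ^ n)⁻¹ * axialMoment n fun y => cone q δ y * g y
        map_add' := fun g h => by
          simp only [axialMoment, BoundedContinuousFunction.coe_add, Pi.add_apply]
          rw [← mul_add, ← integral_add (hint n g) (hint n h)]
          congr 2
          ext y
          ring
        map_smul' := fun c g => by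
          simp only [axialMoment, BoundedContinuousFunction.coe_smul, smul_eq_mul,
            RingHom.id_apply]
          rw [mul_left_comm, ← integral_const_mul c]
          congr 2
          ext y
          ring }
      ((s ^ n)⁻¹ * ∫ y, |zonal n y * cone q δ y|) (fun g => by
        simp only [LinearMap.coe_mk, AddHom.coe_mk, norm_mul, norm_inv, norm_pow,
          Real.norm_of_nonneg hs.le]
        rw [mul_assoc]
        gcongr
        refine (norm_integral_le_integral_norm _).trans ?_
        rw [← integral_mul_const]
        refine integral_mono (hint n g).norm ((integrable_zonal_cone n q δ).abs.mul_const _)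
          fun y => ?_
        simp only
        rw [← mul_assoc, norm_mul, Real.norm_eq_abs (_ * _)]
        gcongr
        exact g.norm_coe_le_norm y)
  have hT : ∀ n g, T n g = (s ^ n)⁻¹ * axialMoment n fun y => cone q δ y * g y :=
    fun n g => rfl
  have hTpos : ∀ g : BoundedContinuousFunction E3 ℝ, (∀ y, 0 ≤ g y) → ∃ C, ∀ n, ‖T n g‖ ≤ C := by
    intro g hg
    obtain ⟨C, hC⟩ := hbdd g hg
    refine ⟨C, fun n => ?_⟩
    rw [hT, norm_mul, norm_inv, norm_pow, Real.norm_of_nonneg hs.le,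
      inv_mul_le_iff₀ (by positivity), mul_comm (s ^ n)]
    exact hC n
  -- Every bounded function is a difference of nonnegative ones.
  obtain ⟨C, hC⟩ := banach_steinhaus (g := T) fun g => by
    obtain ⟨C₁, h₁⟩ := hTpos (g + BoundedContinuousFunction.const E3 ‖g‖) fun y => by
      have := neg_le_of_abs_le (g.norm_coe_le_norm y)
      simp only [BoundedContinuousFunction.coe_add, Pi.add_apply,
        BoundedContinuousFunction.const_apply]
      linarith
    obtain ⟨C₂, h₂⟩ := hTpos (BoundedContinuousFunction.const E3 ‖g‖) fun y => by simp
    refine ⟨C₁ + C₂, fun n => ?_⟩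
    have : T n g = T n (g + BoundedContinuousFunction.const E3 ‖g‖) -
        T n (BoundedContinuousFunction.const E3 ‖g‖) := by simp
    rw [this]
    exact (norm_sub_le _ _).trans (add_le_add (h₁ n) (h₂ n))
  refine not_integral_zonal_cone_le hδ hs hsρ
    (fun y hy => hball y (Metric.ball_subset_closedBall hy))
    (C + (volume (Metric.ball q δ)).toReal) fun n => ?_
  set a : E3 → ℝ := fun y => zonal n y * cone q δ y with ha
  have hcont : Continuous a := by
    rw [continuous_iff_continuousAt]
    intro y
    by_cases hy : y = 0
    · have h0 : (0 : E3) ∈ (Metric.closedBall q δ)ᶜ := fun h => by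
        have := hball 0 h
        rw [norm_zero] at this
        linarith
      have : a =ᶠ[𝓝 y] fun _ => 0 := by
        rw [hy]
        filter_upwards [Metric.isClosed_closedBall.isOpen_compl.mem_nhds h0] with z hz
        simp [ha, cone_eq_zero fun h => hz (Metric.ball_subset_closedBall h)]
      exact continuousAt_const.congr this.symm
    · exact (continuousAt_zonal n hy).mul (continuous_cone q δ).continuousAt
  have hκ : 0 < s ^ n := by positivity
  have hden : ∀ y, 0 < |a y| + s ^ n := fun y => by positivity
  -- The regularized sign of `a`, with a regularization parameter as small as the bound aimed at.
  let g : BoundedContinuousFunction E3 ℝ := BoundedContinuousFunction.ofNormedAddCommGroup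
    (fun y => a y / (|a y| + s ^ n)) (hcont.div (by fun_prop) fun y => (hden y).ne') 1 fun y => by
      rw [norm_div, Real.norm_eq_abs, Real.norm_of_nonneg (hden y).le]
      exact div_le_one_of_le₀ (by linarith) (hden y).le
  have hg1 : ‖g‖ ≤ 1 := BoundedContinuousFunction.norm_ofNormedAddCommGroup_le _ zero_le_one _
  have hTg : axialMoment n (fun y => cone q δ y * g y) ≤ C * s ^ n := by
    have h := ((T n).le_of_opNorm_le (hC n) g).trans
      (mul_le_of_le_one_right ((norm_nonneg _).trans (hC n)) hg1)
    rw [hT, norm_mul, norm_inv, norm_pow, Real.norm_of_nonneg hs.le,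
      inv_mul_le_iff₀ hκ, mul_comm (s ^ n)] at h
    exact (le_abs_self _).trans h
  have hpt : ∀ y, |a y| ≤ zonal n y * (cone q δ y * g y) +
      (Metric.ball q δ).indicator (fun _ => s ^ n) y := fun y => by
    by_cases hy : y ∈ Metric.ball q δ
    · rw [Set.indicator_of_mem hy]
      change |a y| ≤ zonal n y * (cone q δ y * (a y / (|a y| + s ^ n))) + s ^ n
      have hsq : a y * a y = |a y| * |a y| := (abs_mul_abs_self _).symm
      have : zonal n y * (cone q δ y * (a y / (|a y| + s ^ n))) =
          |a y| * |a y| / (|a y| + s ^ n) := by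
        rw [← hsq, ha]; ring
      rw [this, ← sub_le_iff_le_add, le_div_iff₀ (hden y)]
      nlinarith
    · simp [ha, cone_eq_zero hy, Set.indicator_of_notMem hy]
  have hind : Integrable ((Metric.ball q δ).indicator fun _ : E3 => s ^ n) :=
    (integrable_indicator_iff measurableSet_ball).2
      (integrableOn_const measure_ball_lt_top.ne)
  calc ∫ y, |a y| ≤ ∫ y, (zonal n y * (cone q δ y * g y) +
        (Metric.ball q δ).indicator (fun _ => s ^ n) y) :=
        integral_mono (integrable_zonal_cone n q δ).abs ((hint n g).add hind) hpt
    _ = axialMoment n (fun y => cone q δ y * g y) + (volume (Metric.ball q δ)).toReal * s ^ n := by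
        rw [integral_add (hint n g) hind, integral_indicator measurableSet_ball, setIntegral_const,
          smul_eq_mul]
        rfl
    _ ≤ (C + (volume (Metric.ball q δ)).toReal) * s ^ n := by
        rw [add_mul]
        gcongr

/-! ### The expansion along the polar axis -/

theorem cos_colatitude (y : E3) : Real.cos (colatitude y) = y 2 / ‖y‖ :=
  Real.cos_arccos (abs_le.1 (abs_coord_div_norm_le y)).1 (abs_le.1 (abs_coord_div_norm_le y)).2

theorem sphericalHarmonic_zero (n : ℕ) (θ φ : ℝ) :
    sphericalHarmonic n 0 θ φ = Real.sqrt (2 * n + 1) * (legendre n).eval (Real.cos θ) := by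
  have : (n.factorial : ℝ) ≠ 0 := by positivity
  simp [sphericalHarmonic, assocLegendre, this]

/-- Only the zonal spherical harmonics survive on the polar axis. -/
theorem sphericalHarmonic_eq_zero (n : ℕ) {m : ℤ} (hm : m ≠ 0) {θ : ℝ}
    (hθ : Real.cos θ ^ 2 = 1) (φ : ℝ) : sphericalHarmonic n m θ φ = 0 := by
  simp [sphericalHarmonic, assocLegendre, hθ, hm]

theorem sheCoeff_zero (f : E3 → ℝ) (n : ℕ) :
    sheCoeff f n 0 = Real.sqrt (2 * n + 1) / (mass f * (2 * n + 1) * brillouinRadius f ^ n) *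
      axialMoment n f := by
  rw [sheCoeff, axialMoment, ← integral_const_mul, ← integral_const_mul]
  congr 1
  ext y
  rw [sphericalHarmonic_zero, cos_colatitude, zonal, div_pow]
  by_cases hR : brillouinRadius f ^ n = 0
  · simp [hR]
  · by_cases hM : mass f = 0
    · simp [hM]
    · field_simp

theorem she_axis (G : ℝ) {f : E3 → ℝ} (hM : mass f ≠ 0) (hR : brillouinRadius f ≠ 0) (k : ℕ)
    {x : E3} (hx : x ≠ 0) (hax : (x 2 / ‖x‖) ^ 2 = 1) :
    she G f k x = ∑ n ∈ Finset.range (k + 1),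
      G * (x 2 / ‖x‖) ^ n * axialMoment n f / ‖x‖ ^ (n + 1) := by
  rw [she, Finset.mul_sum]
  refine Finset.sum_congr rfl fun n _ => ?_
  rw [Finset.sum_eq_single 0]
  · rw [sheCoeff_zero, sphericalHarmonic_zero, cos_colatitude, legendre_eval_of_sq_eq_one hax,
      div_pow]
    have hn : (0 : ℝ) ≤ 2 * n + 1 := by positivity
    have hs := Real.mul_self_sqrt hn
    have hx' : ‖x‖ ≠ 0 := norm_ne_zero_iff.2 hx
    have hn' : (2 * n + 1 : ℝ) ≠ 0 := by positivity
    set σ := x 2 / ‖x‖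
    field_simp
    rw [sq, hs]
    field_simp
    ring
  · intro m _ hm
    rw [sphericalHarmonic_eq_zero n hm (by rwa [cos_colatitude])]
    ring
  · intro h
    exact absurd (Finset.mem_Icc.2 ⟨by omega, by omega⟩) h

/-- If the expansion descends to a point of the polar axis, the axial moments grow at most like the
powers of the distance of that point from the origin. -/
theorem Descends.axialMoment_le {G ε : ℝ} (hG : G ≠ 0) {f : E3 → ℝ} (hd : Descends G f ε)
    (hM : mass f ≠ 0) (hR : brillouinRadius f ≠ 0) {x : E3} (hx : x ≠ 0)
    (hax : (x 2 / ‖x‖) ^ 2 = 1) (hfree : x ∈ freeSpace f) (hxε : brillouinRadius f - ε < ‖x‖)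
    (hxR : ‖x‖ < brillouinRadius f) : ∃ C, ∀ n, |axialMoment n f| ≤ C * ‖x‖ ^ n := by
  obtain ⟨r, hr, hrx⟩ := exists_between hxε
  obtain ⟨g, hg⟩ := hd r hr
  have hlim := hg.tendsto_at (x := x) ⟨hfree, hrx, hxR⟩
  set u : ℕ → ℝ := fun n => G * (x 2 / ‖x‖) ^ n * axialMoment n f / ‖x‖ ^ (n + 1) with hu
  have hshe : (fun k => she G f k x) = fun k => ∑ n ∈ Finset.range (k + 1), u n := by
    ext k
    exact she_axis G hM hR k hx hax
  rw [hshe] at hlim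
  have hu0 : Tendsto (fun k => u (k + 1)) atTop (𝓝 0) := by
    have h := ((tendsto_add_atTop_iff_nat 1).2 hlim).sub hlim
    simpa [Finset.sum_range_succ _ (_ + 1)] using h
  obtain ⟨C, hC⟩ := ((tendsto_add_atTop_iff_nat 1).1 hu0).norm.bddAbove_range
  have hxn : 0 < ‖x‖ := norm_pos_iff.2 hx
  refine ⟨C * ‖x‖ / |G|, fun n => ?_⟩
  have h : ‖u n‖ ≤ C := hC ⟨n, rfl⟩
  have hσ : |x 2 / ‖x‖| = 1 := by
    rwa [← sq_abs, pow_eq_one_iff_of_nonneg (abs_nonneg _) two_ne_zero] at hax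
  rw [hu, Real.norm_eq_abs, abs_div, abs_mul, abs_mul, abs_pow, hσ, one_pow, mul_one, abs_pow,
    abs_norm, div_le_iff₀ (by positivity)] at h
  rw [div_mul_eq_mul_div, le_div_iff₀ (abs_pos.2 hG)]
  calc _ = |G| * |axialMoment n f| := mul_comm _ _
    _ ≤ _ := h
    _ = _ := by ring

/-! ### The Brillouin sphere and the free space -/

theorem IsPlanet.exists_farthest {f : E3 → ℝ} (hf : IsPlanet f) :
    ∃ y ∈ tsupport f, (∀ z ∈ tsupport f, ‖z‖ ≤ ‖y‖) ∧ 0 < ‖y‖ := by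
  obtain ⟨y, hy, hmax⟩ := hf.hasCompactSupport.isCompact.exists_isMaxOn hf.isConnected.nonempty
    continuous_norm.continuousOn
  refine ⟨y, hy, fun z hz => hmax hz, ?_⟩
  by_contra h
  have hsub : interior (tsupport f) ⊆ {0} := fun z hz => by
    have : ‖z‖ ≤ ‖y‖ := hmax (interior_subset hz)
    exact norm_le_zero_iff.1 (this.trans (not_lt.1 h))
  have hopen : IsOpen ({0} : Set E3) := by
    rw [← Set.Subset.antisymm hsub (Set.singleton_subset_iff.2 hf.zero_mem)]
    exact isOpen_interior
  exact not_isOpen_singleton (0 : E3) hopen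

theorem brillouinRadius_eq {f : E3 → ℝ} {y : E3} (hy : y ∈ tsupport f)
    (hmax : ∀ z ∈ tsupport f, ‖z‖ ≤ ‖y‖) : brillouinRadius f = ‖y‖ := by
  have : {r : ℝ | tsupport f ⊆ Metric.ball 0 r} = Set.Ioi ‖y‖ := by
    ext r
    refine ⟨fun h => by simpa using h hy, fun h z hz => ?_⟩
    simpa using (hmax z hz).trans_lt h
  rw [brillouinRadius, this, csInf_Ioi]

theorem mem_freeSpace_of_subset_closedBall {f : E3 → ℝ} {v x : E3} {R : ℝ} (hR : 0 ≤ R)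
    (hsub : tsupport f ⊆ Metric.closedBall v R) (hx : R < ‖x - v‖) : x ∈ freeSpace f := by
  have hray : ∀ c ∈ Set.Ici (0 : ℝ), x + c • (x - v) ∈ (tsupport f)ᶜ := fun c hc h => by
    have h1 := hsub h
    rw [mem_closedBall_iff_norm, show x + c • (x - v) - v = (1 + c) • (x - v) by module,
      norm_smul, Real.norm_of_nonneg (by linarith [Set.mem_Ici.1 hc])] at h1
    nlinarith [Set.mem_Ici.1 hc, norm_nonneg (x - v)]
  have hx0 : x ∈ (tsupport f)ᶜ := by simpa using hray 0 Set.self_mem_Ici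
  refine ⟨hx0, fun hb => ?_⟩
  have hconn : IsPreconnected ((fun c : ℝ => x + c • (x - v)) '' Set.Ici 0) :=
    isPreconnected_Ici.image _ (by fun_prop)
  have hsubset := hconn.subset_connectedComponentIn (x := x) ⟨0, Set.self_mem_Ici, by simp⟩
    (by rintro _ ⟨c, hc, rfl⟩; exact hray c hc)
  obtain ⟨B, hB⟩ := (hb.subset hsubset).exists_norm_le
  have hpos : 0 < ‖x - v‖ := hR.trans_lt hx
  set c := (|B| + ‖x‖ + 1) / ‖x - v‖ with hc
  have hc0 : 0 ≤ c := by positivity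
  have h1 := hB _ ⟨c, hc0, rfl⟩
  have h2 : ‖c • (x - v)‖ = |B| + ‖x‖ + 1 := by
    rw [norm_smul, Real.norm_of_nonneg hc0, hc]
    field_simp
  have h3 : ‖c • (x - v)‖ ≤ ‖x + c • (x - v)‖ + ‖x‖ := by
    have := norm_sub_le (x + c • (x - v)) x
    simpa using this
  have h1' : ‖x + c • (x - v)‖ ≤ B := h1
  linarith [le_abs_self B]

theorem hausdorffDist_sphere_le {r t : ℝ} (hr : 0 < r) (ht : 0 ≤ t) :
    Metric.hausdorffDist (Metric.sphere (0 : E3) r) (Metric.sphere (0 : E3) (r + t)) ≤ t := by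
  have hrt : 0 < r + t := by linarith
  have key : ∀ a b : ℝ, 0 < a → 0 < b → |a - b| = t → ∀ x ∈ Metric.sphere (0 : E3) a,
      ∃ y ∈ Metric.sphere (0 : E3) b, dist x y ≤ t := by
    intro a b ha hb hab x hx
    rw [mem_sphere_zero_iff_norm] at hx
    refine ⟨(b / a) • x, ?_, ?_⟩
    · rw [mem_sphere_zero_iff_norm, norm_smul, hx, Real.norm_of_nonneg (by positivity)]
      field_simp
    · rw [dist_eq_norm, show x - (b / a) • x = ((a - b) / a) • x by
        rw [sub_div, div_self ha.ne']; module, norm_smul, hx, Real.norm_eq_abs, abs_div,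
        abs_of_pos ha, hab]
      exact (div_mul_cancel₀ _ ha.ne').le
  refine Metric.hausdorffDist_le_of_mem_dist ht (key _ _ hr hrt ?_) (key _ _ hrt hr ?_)
  · rw [sub_add_cancel_left, abs_neg, abs_of_nonneg ht]
  · rw [add_sub_cancel_left, abs_of_nonneg ht]

/-! ### Translated planets and planets with the same support -/

theorem tsupport_translate (f : E3 → ℝ) (v : E3) :
    tsupport (fun x => f (x - v)) = (fun x => x + v) '' tsupport f := by
  have h := tsupport_comp_eq_preimage f (Homeomorph.subRight v)
  rw [← Homeomorph.image_symm] at h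
  exact h

theorem hausdorffDist_image_add_le (s : Set E3) (v : E3) :
    Metric.hausdorffDist ((fun x => x + v) '' s) s ≤ ‖v‖ := by
  refine Metric.hausdorffDist_le_of_mem_dist (norm_nonneg v) ?_ ?_
  · rintro _ ⟨x, hx, rfl⟩
    exact ⟨x, hx, by simp⟩
  · intro x hx
    exact ⟨x + v, ⟨x, hx, rfl⟩, by simp⟩

theorem IsClosedSurface.image {S : Set E3} (hS : IsClosedSurface S) (e : E3 ≃ₜ E3) :
    IsClosedSurface (e '' S) where
  isCompact := hS.isCompact.image e.continuous
  isConnected := hS.isConnected.image e e.continuous.continuousOn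
  locallyEuclidean := by
    obtain ⟨c⟩ := hS.locallyEuclidean
    let h : (e '' S : Set E3) ≃ₜ S := (e.image S).symm
    exact ⟨{
      atlas := {φ | ∃ x : S, φ = h.toOpenPartialHomeomorph.trans (chartAt _ x)}
      chartAt := fun x => h.toOpenPartialHomeomorph.trans (chartAt _ (h x))
      mem_chart_source := fun x => by simp
      chart_mem_atlas := fun x => ⟨h x, rfl⟩ }⟩

theorem IsPlanet.translate {f : E3 → ℝ} (hf : IsPlanet f) {v : E3}
    (hv : -v ∈ interior (tsupport f)) : IsPlanet fun x => f (x - v) := by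
  let e : E3 ≃ₜ E3 := Homeomorph.addRight v
  have he : tsupport (fun x => f (x - v)) = e '' tsupport f := tsupport_translate f v
  refine ⟨hf.continuous.comp (by fun_prop), fun x => hf.nonneg _, ?_, ?_, ?_, ?_⟩
  · rw [HasCompactSupport, he]
    exact hf.hasCompactSupport.isCompact.image e.continuous
  · rw [he]
    exact hf.isConnected.image e e.continuous.continuousOn
  · obtain ⟨m, S, hS, hdisj, hfr⟩ := hf.boundary
    refine ⟨m, fun i => e '' S i, fun i => (hS i).image e, fun i j hij => ?_, ?_⟩
    · exact (Set.disjoint_image_iff e.injective).2 (hdisj hij)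
    · rw [he, ← e.image_frontier, hfr, Set.image_iUnion]
  · rw [he, ← e.image_interior]
    exact ⟨-v, hv, by simp [e]⟩

theorem IsPlanet.of_support_eq {f g : E3 → ℝ} (hf : IsPlanet f) (hg : Continuous g)
    (hg0 : ∀ x, 0 ≤ g x) (h : Function.support g = Function.support f) : IsPlanet g := by
  have ht : tsupport g = tsupport f := by rw [tsupport, h, tsupport]
  refine ⟨hg, hg0, ?_, ?_, ?_, ?_⟩
  · rw [HasCompactSupport, ht]
    exact hf.hasCompactSupport
  · exact ht ▸ hf.isConnected
  · exact ht ▸ hf.boundary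
  · exact ht ▸ hf.zero_mem

theorem IsPlanet.mass_pos {f : E3 → ℝ} (hf : IsPlanet f) : 0 < mass f := by
  obtain ⟨x, hx⟩ : ∃ x, f x ≠ 0 := by
    by_contra! h
    have : f = 0 := funext h
    have h0 := interior_subset hf.zero_mem
    simp [this] at h0
  exact hf.continuous.integral_pos_of_hasCompactSupport_nonneg_nonzero hf.hasCompactSupport
    hf.nonneg hx

/-! ### Continuity of weighted norms and potentials -/

/-- Functions vanishing outside a fixed ball are small in the weighted norm when they are uniformly
small. -/
theorem exists_weightedNorm_lt {p : ℝ≥0∞} (hp : 1 ≤ p) {w : E3 → ℝ} (hw : Continuous w) (ρ : ℝ)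
    {ε : ℝ} (hε : 0 < ε) : ∃ κ, 0 < κ ∧ ∀ g : E3 → ℝ, (∀ x, |g x| ≤ κ) →
      (∀ x, x ∉ Metric.closedBall (0 : E3) ρ → g x = 0) →
      weightedNorm p w g < ENNReal.ofReal ε := by
  have henorm : ∀ {g : E3 → ℝ} {κ : ℝ}, (∀ x, |g x| ≤ κ) → ∀ x, ‖g x‖ₑ ≤ ENNReal.ofReal κ :=
    fun h x => by
      rw [← ofReal_norm, Real.norm_eq_abs]
      exact ENNReal.ofReal_le_ofReal (h x)
  by_cases hpt : p = ⊤
  · refine ⟨ε / 2, by positivity, fun g hg _ => ?_⟩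
    rw [weightedNorm, if_pos hpt]
    exact (iSup_le (henorm hg)).trans_lt ((ENNReal.ofReal_lt_ofReal_iff hε).2 (by linarith))
  have hq : 0 < p.toReal := ENNReal.toReal_pos (by rintro rfl; simp at hp) hpt
  set q := p.toReal
  set W : ℝ≥0∞ := ∫⁻ x in Metric.closedBall (0 : E3) ρ, ENNReal.ofReal (w x) with hW
  have hWfin : W ≠ ⊤ := by
    have hi : IntegrableOn w (Metric.closedBall (0 : E3) ρ) :=
      hw.continuousOn.integrableOn_compact (isCompact_closedBall _ _)
    exact ((lintegral_mono fun x => Real.ofReal_le_enorm (w x)).trans_lt hi.2).ne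
  set A : ℝ := (W ^ (1 / q)).toReal with hA
  have hWA : W ^ (1 / q) = ENNReal.ofReal A :=
    (ENNReal.ofReal_toReal (ENNReal.rpow_ne_top_of_nonneg (by positivity) hWfin)).symm
  have hA0 : 0 ≤ A := ENNReal.toReal_nonneg
  refine ⟨ε / (A + 1), by positivity, fun g hg hg0 => ?_⟩
  set κ := ε / (A + 1) with hκ
  have hκ0 : 0 < κ := by positivity
  rw [weightedNorm, if_neg hpt]
  have hint : ∫⁻ x, ‖g x‖ₑ ^ q * ENNReal.ofReal (w x) ≤ ENNReal.ofReal κ ^ q * W := by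
    rw [hW, ← lintegral_const_mul _ (by fun_prop),
      ← lintegral_indicator Metric.isClosed_closedBall.measurableSet]
    refine lintegral_mono fun x => ?_
    by_cases hx : x ∈ Metric.closedBall (0 : E3) ρ
    · rw [Set.indicator_of_mem hx]
      gcongr
      exact henorm hg x
    · simp [hg0 x hx, ENNReal.zero_rpow_of_pos hq]
  calc (∫⁻ x, ‖g x‖ₑ ^ q * ENNReal.ofReal (w x)) ^ (1 / q)
      ≤ (ENNReal.ofReal κ ^ q * W) ^ (1 / q) := by gcongr
    _ = ENNReal.ofReal κ * ENNReal.ofReal A := by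
        rw [ENNReal.mul_rpow_of_nonneg _ _ (by positivity), ← ENNReal.rpow_mul,
          mul_one_div_cancel hq.ne', ENNReal.rpow_one, hWA]
    _ = ENNReal.ofReal (κ * A) := (ENNReal.ofReal_mul hκ0.le).symm
    _ < ENNReal.ofReal ε := by
        rw [ENNReal.ofReal_lt_ofReal_iff hε, hκ, div_mul_eq_mul_div, div_lt_iff₀ (by positivity)]
        nlinarith

/-- The Newtonian kernel, cut off at distance `r`. -/
noncomputable def newtonKernel (r : ℝ) (z : E3) : ℝ :=
  (Metric.ball (0 : E3) r).indicator (fun z => ‖z‖⁻¹) z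

theorem integrable_newtonKernel (r : ℝ) : Integrable (newtonKernel r) := by
  refine (integrable_indicator_iff measurableSet_ball).2 ?_
  refine integrableOn_ball_of_norm_le_rpow (C := 1) (α := 1) (by simp) (by simp)
    (Eventually.of_forall fun z => ?_) ?_
  · simp [Real.rpow_neg_one]
  · exact measurable_norm.inv.aestronglyMeasurable

theorem newtonKernel_nonneg (r : ℝ) (z : E3) : 0 ≤ newtonKernel r z :=
  Set.indicator_nonneg (fun _ _ => by positivity) _

theorem abs_div_norm_le_newtonKernel {g : E3 → ℝ} {κ ρ N : ℝ} (hg : ∀ x, |g x| ≤ κ)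
    (hg0 : ∀ x, x ∉ Metric.closedBall (0 : E3) ρ → g x = 0) {x : E3} (hx : ‖x‖ ≤ N) (y : E3) :
    |g y / ‖x - y‖| ≤ κ * newtonKernel (N + ρ + 1) (x - y) := by
  have hκ : 0 ≤ κ := (abs_nonneg _).trans (hg 0)
  by_cases hy : y ∈ Metric.closedBall (0 : E3) ρ
  · have hmem : x - y ∈ Metric.ball (0 : E3) (N + ρ + 1) := by
      rw [mem_closedBall_zero_iff] at hy
      rw [mem_ball_zero_iff]
      linarith [norm_sub_le x y]
    rw [newtonKernel, Set.indicator_of_mem hmem, abs_div, abs_norm, div_eq_mul_inv]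
    exact mul_le_mul_of_nonneg_right (hg y) (by positivity)
  · rw [hg0 y hy, zero_div, abs_zero]
    exact mul_nonneg hκ (newtonKernel_nonneg _ _)

theorem integrable_div_norm_sub {g : E3 → ℝ} (hg : Continuous g) (hc : HasCompactSupport g)
    (x : E3) : Integrable fun y => g y / ‖x - y‖ := by
  obtain ⟨ρ, hρ⟩ := hc.isCompact.isBounded.subset_closedBall 0
  obtain ⟨κ, hκ⟩ := hg.bounded_above_of_compact_support hc
  refine (((integrable_newtonKernel (‖x‖ + ρ + 1)).comp_sub_left x).const_mul κ).mono' ?_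
    (Eventually.of_forall fun y => abs_div_norm_le_newtonKernel hκ
      (fun z hz => image_eq_zero_of_notMem_tsupport fun h => hz (hρ h)) le_rfl y)
  exact (hg.measurable.div (by fun_prop)).aestronglyMeasurable

theorem abs_potential_sub_le {G : ℝ} (hG : 0 ≤ G) {f g : E3 → ℝ} (hf : Continuous f)
    (hfc : HasCompactSupport f) (hg : Continuous g) (hgc : HasCompactSupport g) {κ ρ N : ℝ}
    (hκ : ∀ x, |f x - g x| ≤ κ) (hρ : ∀ x, x ∉ Metric.closedBall (0 : E3) ρ → f x - g x = 0)
    {x : E3} (hx : ‖x‖ ≤ N) :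
    |potential G f x - potential G g x| ≤ κ * (G * ∫ z, newtonKernel (N + ρ + 1) z) := by
  have hdiff : potential G f x - potential G g x = G * ∫ y, (f y - g y) / ‖x - y‖ := by
    rw [potential, potential, ← mul_sub, ← integral_sub (integrable_div_norm_sub hf hfc x)
      (integrable_div_norm_sub hg hgc x)]
    simp only [sub_div]
  rw [hdiff, abs_mul, abs_of_nonneg hG, mul_left_comm]
  refine mul_le_mul_of_nonneg_left ?_ hG
  rw [← integral_sub_left_eq_self (newtonKernel _) volume x, ← integral_const_mul]
  exact norm_integral_le_of_norm_le (f := fun y => (f y - g y) / ‖x - y‖)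
    (((integrable_newtonKernel (N + ρ + 1)).comp_sub_left x).const_mul κ)
    (Eventually.of_forall fun y =>
      abs_div_norm_le_newtonKernel (g := fun y => f y - g y) hκ hρ hx y)

/-- Densities that are uniformly close to `f` and agree with it outside a fixed ball are close to `f`
in the weighted norm, and so are their potentials on bounded sets. -/
theorem exists_uniform_closeness {G : ℝ} (hG : 0 ≤ G) {f : E3 → ℝ} (hf : Continuous f)
    (hfc : HasCompactSupport f) {p : ℝ≥0∞} (hp : 1 ≤ p) {w : E3 → ℝ} (hw : Continuous w)
    (N ρ : ℝ) {ε : ℝ} (hε : 0 < ε) :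
    ∃ κ, 0 < κ ∧ ∀ g : E3 → ℝ, Continuous g → HasCompactSupport g → (∀ x, |f x - g x| ≤ κ) →
      (∀ x, x ∉ Metric.closedBall (0 : E3) ρ → f x - g x = 0) →
      weightedDist p w f g < ENNReal.ofReal ε ∧
      weightedDistOn N p w (potential G f) (potential G g) < ENNReal.ofReal ε := by
  obtain ⟨κ₁, h₁, hκ₁⟩ := exists_weightedNorm_lt hp hw ρ hε
  obtain ⟨κ₂, h₂, hκ₂⟩ := exists_weightedNorm_lt hp hw N hε
  set A : ℝ := G * ∫ z, newtonKernel (N + ρ + 1) z with hA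
  have hA0 : 0 ≤ A := mul_nonneg hG (integral_nonneg (newtonKernel_nonneg _))
  refine ⟨min κ₁ (κ₂ / (A + 1)), by positivity, fun g hg hgc hκ hρ => ⟨?_, ?_⟩⟩
  · exact hκ₁ _ (fun x => (hκ x).trans (min_le_left _ _)) hρ
  · refine hκ₂ _ (fun x => ?_) fun x hx => Set.indicator_of_notMem hx _
    by_cases hx : x ∈ Metric.closedBall (0 : E3) N
    · rw [Set.indicator_of_mem hx]
      refine (abs_potential_sub_le hG hf hfc hg hgc hκ hρ (mem_closedBall_zero_iff.1 hx)).trans ?_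
      calc min κ₁ (κ₂ / (A + 1)) * A ≤ κ₂ / (A + 1) * (A + 1) := by
            gcongr
            · exact min_le_right _ _
            · linarith
        _ = κ₂ := by field_simp
    · rw [Set.indicator_of_notMem hx, abs_zero]
      exact h₂.le

/-! ### Planets whose expansion does not descend -/

/-- A point of the polar axis at distance `R` from the origin, in the closed half-space opposite
to `y`. -/
theorem exists_polar_point {R : ℝ} (hR : 0 < R) (y : E3) :
    ∃ x : E3, ‖x‖ = R ∧ (x 2 / ‖x‖) ^ 2 = 1 ∧ inner ℝ x y ≤ 0 := by
  obtain ⟨σ, hσ, hσy⟩ : ∃ σ : ℝ, |σ| = 1 ∧ σ * y 2 ≤ 0 := by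
    rcases le_total (y 2) 0 with h | h
    · exact ⟨1, by simp, by simpa using h⟩
    · exact ⟨-1, by simp, by simpa using h⟩
  have hnorm : ‖EuclideanSpace.single (2 : Fin 3) (R * σ)‖ = R := by
    rw [PiLp.norm_single, Real.norm_eq_abs, abs_mul, hσ, abs_of_pos hR, mul_one]
  refine ⟨EuclideanSpace.single 2 (R * σ), hnorm, ?_, ?_⟩
  · rw [hnorm, PiLp.single_apply, if_pos rfl, mul_div_cancel_left₀ _ hR.ne', ← sq_abs, hσ, one_pow]
  · rw [EuclideanSpace.inner_single_left]
    simp only [conj_trivial]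
    nlinarith

/-- A density `η` that is added in a region beyond a point of the polar axis, and whose axial moments
outgrow the powers of the distance of that point, spoils the descent of every planet: the
expansion cannot descend both with and without `η`. -/
theorem not_descends_or_not_descends_add {G ε : ℝ} (hG : G ≠ 0) {f η : E3 → ℝ} (hf : IsPlanet f)
    (hfη : ∀ c, 0 < c → IsPlanet fun x => f x + c * η x)
    (hsupp : ∀ c, 0 < c → Function.support (fun x => f x + c * η x) = Function.support f)
    (hη : Continuous η) (hηc : HasCompactSupport η) {x : E3} (hx : x ≠ 0)
    (hax : (x 2 / ‖x‖) ^ 2 = 1) (hfree : x ∈ freeSpace f) (hxε : brillouinRadius f - ε < ‖x‖)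
    (hxR : ‖x‖ < brillouinRadius f) (hmom : ∀ C, ∃ n, C * ‖x‖ ^ n < |axialMoment n η|)
    {c : ℝ} (hc : 0 < c) :
    ¬ Descends G f ε ∨ ¬ Descends G (fun x => f x + c * η x) ε := by
  by_contra! h
  set g : E3 → ℝ := fun x => f x + c * η x with hg
  have ht : tsupport g = tsupport f := by rw [tsupport, hsupp c hc, tsupport]
  have hB : brillouinRadius g = brillouinRadius f := by rw [brillouinRadius, ht, brillouinRadius]
  have hF : freeSpace g = freeSpace f := by rw [freeSpace, ht, freeSpace]
  have hR : brillouinRadius f ≠ 0 := ((norm_nonneg x).trans_lt hxR).ne'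
  obtain ⟨C₁, h₁⟩ := h.1.axialMoment_le hG hf.mass_pos.ne' hR hx hax hfree hxε hxR
  obtain ⟨C₂, h₂⟩ := h.2.axialMoment_le hG (hfη c hc).mass_pos.ne' (hB ▸ hR) hx hax
    (hF ▸ hfree) (hB ▸ hxε) (hB ▸ hxR)
  obtain ⟨n, hn⟩ := hmom ((C₁ + C₂) / c)
  have h₃ := h₂ n
  rw [hg, axialMoment_add_smul n hf.continuous hf.hasCompactSupport hη hηc] at h₃
  have h₄ : |c * axialMoment n η| ≤ (C₁ + C₂) * ‖x‖ ^ n := by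
    have := abs_sub (axialMoment n f + c * axialMoment n η) (axialMoment n f)
    rw [add_sub_cancel_left] at this
    linarith [h₁ n]
  rw [abs_mul, abs_of_pos hc] at h₄
  rw [div_mul_eq_mul_div, div_lt_iff₀ hc] at hn
  linarith

end Planet

open Planet in
theorem theorem1 (G : ℝ) (hG : 0 < G) (f : Planet.E3 → ℝ) (hf : Planet.IsPlanet f)
    (p : ENNReal) (hp : 1 ≤ p)
    (w : Planet.E3 → ℝ) (hw : ContDiff ℝ ((⊤ : ℕ∞) : WithTop ℕ∞) w) (hw0 : ∀ x, 0 ≤ w x)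
    (N : ℝ) (hN : 0 < N) (ε : ℝ) (hε : 0 < ε) :
    ∃ fε : Planet.E3 → ℝ, Planet.IsPlanet fε ∧
      Planet.weightedDist p w f fε < ENNReal.ofReal ε ∧
      Metric.hausdorffDist (tsupport fε) (tsupport f) < ε ∧
      Metric.hausdorffDist (frontier (tsupport fε)) (frontier (tsupport f)) < ε ∧
      Planet.weightedDistOn N p w (Planet.potential G f) (Planet.potential G fε) <
        ENNReal.ofReal ε ∧
      Metric.hausdorffDist (Planet.brillouinSphere f) (Planet.brillouinSphere fε) < ε ∧
      ¬ Planet.Descends G fε ε := by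
  obtain ⟨y, hy, hmax, hR⟩ := hf.exists_farthest
  have hRf : brillouinRadius f = ‖y‖ := brillouinRadius_eq hy hmax
  set R := ‖y‖ with hRdef
  obtain ⟨κ, hκ, hclose⟩ := exists_uniform_closeness hG.le hf.continuous hf.hasCompactSupport hp
    hw.continuous N (R + 1) hε
  obtain ⟨δ, hδ, huc⟩ := Metric.uniformContinuous_iff.1
    (hf.hasCompactSupport.uniformContinuous_of_continuous hf.continuous) (κ / 2)
      (by positivity)
  obtain ⟨ρ, hρ, hρball⟩ := Metric.isOpen_iff.1 isOpen_interior _ hf.zero_mem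
  obtain ⟨t, ht0, ht⟩ := exists_between (show 0 < min (min ε 1) (min δ ρ) by positivity)
  obtain ⟨⟨htε, ht1⟩, htδ, htρ⟩ : (t < ε ∧ t < 1) ∧ t < δ ∧ t < ρ := by simpa using ht
  -- Translate the planet outwards, in the direction of its farthest point.
  set v : E3 := (t / R) • y with hv
  have hvn : ‖v‖ = t := by
    rw [hv, norm_smul, Real.norm_of_nonneg (by positivity), ← hRdef]
    field_simp
  set f' : E3 → ℝ := fun x => f (x - v) with hf'
  have hplanet' : IsPlanet f' := hf.translate (hρball (by simpa [hvn] using htρ))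
  have hts : tsupport f' = (fun x => x + v) '' tsupport f := tsupport_translate f v
  have hff' : ∀ x, |f x - f' x| ≤ κ / 2 := fun x => by
    have h := huc (a := x) (b := x - v) (by simpa [hvn] using htδ)
    rw [Real.dist_eq] at h
    exact h.le
  have hRf' : brillouinRadius f' = R + t := by
    have hyv : ‖y + v‖ = R + t := by
      rw [hv, show y + (t / R) • y = (1 + t / R) • y by module, norm_smul,
        Real.norm_of_nonneg (by positivity), ← hRdef]
      field_simp
    rw [← hyv]
    refine brillouinRadius_eq (hts ▸ ⟨y, hy, rfl⟩) ?_
    rw [hts]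
    rintro _ ⟨z, hz, rfl⟩
    rw [hyv]
    exact (norm_add_le z v).trans (add_le_add (hmax z hz) hvn.le)
  have hsub : tsupport f' ⊆ Metric.closedBall v R := by
    rw [hts]
    rintro _ ⟨z, hz, rfl⟩
    simpa using hmax z hz
  -- On the polar axis, the sphere of radius `R` meets the free space of the translated planet.
  obtain ⟨x, hxn, hax, hxy⟩ := exists_polar_point hR y
  have hfree : x ∈ freeSpace f' := by
    refine mem_freeSpace_of_subset_closedBall hR.le hsub ?_
    refine lt_of_pow_lt_pow_left₀ 2 (norm_nonneg _) ?_
    rw [norm_sub_sq_real, hxn, hvn, hv, inner_smul_right]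
    have : t / R * inner ℝ x y ≤ 0 := mul_nonpos_of_nonneg_of_nonpos (by positivity) hxy
    nlinarith
  -- The translated planet has positive density somewhere beyond radius `R`.
  obtain ⟨q, hq⟩ : ∃ q, f' q ≠ 0 ∧ R < ‖q‖ := by
    have hopen : IsOpen {z : E3 | R < ‖z‖} := isOpen_lt continuous_const continuous_norm
    have hmem : y + v ∈ tsupport f' := hts ▸ ⟨y, hy, rfl⟩
    have hyv : y + v ∈ {z : E3 | R < ‖z‖} := by
      rw [Set.mem_ofPred_eq, hv, show y + (t / R) • y = (1 + t / R) • y by module, norm_smul,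
        Real.norm_of_nonneg (by positivity), ← hRdef]
      have : 0 < t / R * R := by positivity
      linarith
    obtain ⟨q, hq1, hq2⟩ := mem_closure_iff.1 hmem _ hopen hyv
    exact ⟨q, hq2, hq1⟩
  obtain ⟨s, hRs, hsq⟩ := exists_between hq.2
  obtain ⟨r, hr, hball⟩ : ∃ r > 0, Metric.closedBall q r ⊆ {z | f' z ≠ 0 ∧ s < ‖z‖} := by
    refine Metric.nhds_basis_closedBall.mem_iff.1 (IsOpen.mem_nhds ?_ ⟨hq.1, hsq⟩)
    exact (isOpen_ne_fun hplanet'.continuous continuous_const).inter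
      (isOpen_lt continuous_const continuous_norm)
  obtain ⟨η, hη, hη0, ⟨b, hb⟩, hηs, hηc, hmom⟩ :=
    exists_unbounded_axialMoment hr hR hRs fun z hz => (hball hz).2.le
  have hb0 : 0 ≤ b := (hη0 0).trans (hb 0)
  have hsupp : ∀ c, 0 < c → Function.support (fun x => f' x + c * η x) = Function.support f' := by
    intro c hc
    ext z
    rw [Function.mem_support, Function.mem_support]
    refine ⟨fun h h0 => ?_, fun h => ?_⟩
    · refine h ?_
      have : η z = 0 := by
        by_contra hz
        exact (hball (Metric.ball_subset_closedBall (hηs hz))).1 h0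
      simp [h0, this]
    · have h1 : 0 < f' z := (hplanet'.nonneg z).lt_of_ne' h
      have h2 : 0 ≤ c * η z := mul_nonneg hc.le (hη0 z)
      exact (by linarith : 0 < f' z + c * η z).ne'
  have hplanet : ∀ c, 0 < c → IsPlanet fun x => f' x + c * η x := fun c hc =>
    hplanet'.of_support_eq (hplanet'.continuous.add (continuous_const.mul hη))
      (fun z => add_nonneg (hplanet'.nonneg z) (mul_nonneg hc.le (hη0 z))) (hsupp c hc)
  -- Planets with the translated support that are uniformly close to `f` satisfy all approximation
  -- requirements.
  have happrox : ∀ g, IsPlanet g → Function.support g = Function.support f' →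
      (∀ x, |f x - g x| ≤ κ) → ¬ Descends G g ε →
      ∃ fε : Planet.E3 → ℝ, Planet.IsPlanet fε ∧
        Planet.weightedDist p w f fε < ENNReal.ofReal ε ∧
        Metric.hausdorffDist (tsupport fε) (tsupport f) < ε ∧
        Metric.hausdorffDist (frontier (tsupport fε)) (frontier (tsupport f)) < ε ∧
        Planet.weightedDistOn N p w (Planet.potential G f) (Planet.potential G fε) <
          ENNReal.ofReal ε ∧
        Metric.hausdorffDist (Planet.brillouinSphere f) (Planet.brillouinSphere fε) < ε ∧
        ¬ Planet.Descends G fε ε := by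
    intro g hg hgs hgκ hgd
    have hgt : tsupport g = (fun x => x + v) '' tsupport f := by
      rw [← hts, tsupport, hgs, tsupport]
    have hgR : brillouinRadius g = R + t := by rw [← hRf', brillouinRadius, hgt, ← hts]; rfl
    have hzero : ∀ z, z ∉ Metric.closedBall (0 : E3) (R + 1) → f z - g z = 0 := by
      intro z hz
      rw [mem_closedBall_zero_iff, not_le] at hz
      have h1 : f z = 0 := image_eq_zero_of_notMem_tsupport fun h => by linarith [hmax z h]
      have h2 : g z = 0 := image_eq_zero_of_notMem_tsupport fun h => by
        rw [hgt, ← hts] at h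
        have := mem_closedBall_iff_norm.1 (hsub h)
        linarith [norm_sub_norm_le z v]
      rw [h1, h2, sub_zero]
    obtain ⟨ha, hc⟩ := hclose g hg.continuous hg.hasCompactSupport hgκ hzero
    refine ⟨g, hg, ha, ?_, ?_, hc, ?_, hgd⟩
    · rw [hgt]
      exact ((hausdorffDist_image_add_le _ v).trans hvn.le).trans_lt htε
    · have : frontier (tsupport g) = (fun x => x + v) '' frontier (tsupport f) := by
        rw [hgt]
        exact ((Homeomorph.addRight v).image_frontier _).symm
      rw [this]
      exact ((hausdorffDist_image_add_le _ v).trans hvn.le).trans_lt htε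
    · rw [brillouinSphere, brillouinSphere, hRf, hgR]
      exact (hausdorffDist_sphere_le hR ht0.le).trans_lt htε
  have hc : 0 < κ / (2 * (b + 1)) := by positivity
  rcases not_descends_or_not_descends_add (ε := ε) hG.ne' hplanet' hplanet hsupp hη hηc
    (norm_pos_iff.1 (hxn ▸ hR)) hax hfree (by rw [hRf', hxn]; linarith)
    (by rw [hRf', hxn]; linarith) (by rwa [hxn]) hc with h | h
  · exact happrox f' hplanet' rfl (fun z => (hff' z).trans (by linarith)) h
  · refine happrox _ (hplanet _ hc) (hsupp _ hc) (fun z => ?_) h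
    have h1 : κ / (2 * (b + 1)) * η z ≤ κ / 2 := by
      rw [div_mul_eq_mul_div, div_le_iff₀ (by positivity)]
      nlinarith [hb z]
    have h2 : 0 ≤ κ / (2 * (b + 1)) * η z := mul_nonneg hc.le (hη0 z)
    have h3 := abs_le.1 (hff' z)
    rw [abs_le]
    constructor <;> linarith
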